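/- Let $X$ be a complex Banach space and $U$ a (real or complex) Banach space, and let $A$ be the generator of a $C_0$-semigroup $(T(t))_{t\ge 0}$ on $X$. Fix $\mu\in\rho(A)$, let the extrapolation space $X_{-1}$ be the completion of $X$ with respect to the norm $\|x\|_{-1}:=\|(\mu-A)^{-1}x\|$, and let $(T_{-1}(t))_{t\ge 0}$ be the extension of the semigroup to $X_{-1}$. Let $B\in\mathcal L(U,X_{-1})$ and, for $u\in L^p([0,t],U)$ and $\tau\in[0,t]$, put $$\Phi_\tau u:=\int_0^\tau T_{-1}(\tau-s)Bu(s)\,ds\in X_{-1}.$$ For $p,q\in[1,\infty]$ the system $\Sigma(A,B)$, i.e. $\dot x(t)=Ax(t)+Bu(t)$, is called finite-time $L^p$-$L^q$-admissible if for some $t>0$ (equivalently, for all $t>0$) and every $u\in L^p([0,t],U)$ one has $\Phi_{(\cdot)}u\in L^q([0,t],X)$ (that is, $\Phi_\tau u\in X$ for almost every $\tau\in[0,t]$, and the resulting $X$-valued function belongs to $L^q([0,t],X)$). It is called infinite-time $L^p$-$L^q$-admissible if it is finite-time $L^p$-$L^q$-admissible and there is a constant $c\ge 0$ with $$\|\Phi_{(\cdot)}u\|_{L^q([0,t],X)}\le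 c\,\|u\|_{L^p([0,t],U)}\qquad\text{for all } t>0 \text{ and all } u\in L^p([0,t],U).$$ **Theorem.** Suppose that the semigroup $(T(t))_{t\ge0}$ is exponentially stable (there are $M,\omega>0$ with $\|T(t)\|\le Me^{-\omega t}$ for all $t\ge0$) and analytic (it extends to a holomorphic semigroup on an open sector around $(0,\infty)$, strongly continuous at $0$), and let $p\in[1,\infty)$. Then $\Sigma(A,B)$ is finite-time $L^p$-$L^p$-admissible if and only if it is infinite-time $L^p$-$L^p$-admissible. -/

import Mathlib

open MeasureTheory Filter Topology
open scoped NNReal ENNReal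

noncomputable section

/-! ### Resolvents of unbounded operators -/

namespace UnboundedOperator

variable {X : Type*} [NormedAddCommGroup X] [NormedSpace ℂ X]

/-- `R` is the (bounded, everywhere defined) two-sided inverse of `μ - A : D(A) → X`. -/
def IsResolvent (A : X →ₗ.[ℂ] X) (μ : ℂ) (R : X →L[ℂ] X) : Prop :=
  (∀ x : X, ∃ h : R x ∈ A.domain, μ • R x - A ⟨R x, h⟩ = x) ∧
    ∀ x : A.domain, R (μ • (x : X) - A x) = x

/-- The resolvent set `ρ(A)`. -/
def resolventSet (A : X →ₗ.[ℂ] X) : Set ℂ := {μ | ∃ R : X →L[ℂ] X, IsResolvent A μ R}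

/-- The resolvent `R(μ, A) = (μ - A)⁻¹` for `μ ∈ ρ(A)`. -/
def resolvent (A : X →ₗ.[ℂ] X) (μ : ℂ) (hμ : μ ∈ resolventSet A) : X →L[ℂ] X :=
  Classical.choose hμ

theorem isResolvent_resolvent (A : X →ₗ.[ℂ] X) (μ : ℂ) (hμ : μ ∈ resolventSet A) :
    IsResolvent A μ (resolvent A μ hμ) :=
  Classical.choose_spec hμ

theorem resolvent_injective (A : X →ₗ.[ℂ] X) (μ : ℂ) (hμ : μ ∈ resolventSet A) :
    Function.Injective (resolvent A μ hμ) := by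
  intro x y hxy
  obtain ⟨h₁, e₁⟩ := (isResolvent_resolvent A μ hμ).1 x
  obtain ⟨h₂, e₂⟩ := (isResolvent_resolvent A μ hμ).1 y
  have : (⟨resolvent A μ hμ x, h₁⟩ : A.domain) = ⟨resolvent A μ hμ y, h₂⟩ := Subtype.ext hxy
  rw [← e₁, ← e₂, this, hxy]

/-! ### The extrapolation space `X₋₁` -/

/-- A copy of the vector space `X`, which carries the norm `‖x‖₋₁ = ‖R(μ, A) x‖`. -/
@[nolint unusedArguments]
def PreExtrapolation (A : X →ₗ.[ℂ] X) (μ : ℂ) (_hμ : μ ∈ resolventSet A) : Type _ := X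

instance (A : X →ₗ.[ℂ] X) (μ : ℂ) (hμ : μ ∈ resolventSet A) :
    AddCommGroup (PreExtrapolation A μ hμ) :=
  inferInstanceAs (AddCommGroup X)

instance (A : X →ₗ.[ℂ] X) (μ : ℂ) (hμ : μ ∈ resolventSet A) :
    Module ℂ (PreExtrapolation A μ hμ) :=
  inferInstanceAs (Module ℂ X)

/-- The identity map from `X` to its copy with the norm `‖·‖₋₁`. -/
def toPre (A : X →ₗ.[ℂ] X) (μ : ℂ) (hμ : μ ∈ resolventSet A) :
    X ≃ₗ[ℂ] PreExtrapolation A μ hμ :=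
  LinearEquiv.refl ℂ X

/-- The resolvent as a linear map on the copy of `X`; it induces the norm `‖·‖₋₁`. -/
def preResolvent (A : X →ₗ.[ℂ] X) (μ : ℂ) (hμ : μ ∈ resolventSet A) :
    PreExtrapolation A μ hμ →ₗ[ℂ] X :=
  (resolvent A μ hμ).toLinearMap ∘ₗ (toPre A μ hμ).symm.toLinearMap

theorem preResolvent_injective (A : X →ₗ.[ℂ] X) (μ : ℂ) (hμ : μ ∈ resolventSet A) :
    Function.Injective (preResolvent A μ hμ) :=
  (resolvent_injective A μ hμ).comp (toPre A μ hμ).symm.injective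

instance (A : X →ₗ.[ℂ] X) (μ : ℂ) (hμ : μ ∈ resolventSet A) :
    NormedAddCommGroup (PreExtrapolation A μ hμ) :=
  NormedAddCommGroup.induced _ X (preResolvent A μ hμ) (preResolvent_injective A μ hμ)

instance (A : X →ₗ.[ℂ] X) (μ : ℂ) (hμ : μ ∈ resolventSet A) :
    NormedSpace ℂ (PreExtrapolation A μ hμ) :=
  NormedSpace.induced ℂ _ X (preResolvent A μ hμ)

theorem norm_toPre (A : X →ₗ.[ℂ] X) (μ : ℂ) (hμ : μ ∈ resolventSet A) (x : X) :
    ‖toPre A μ hμ x‖ = ‖resolvent A μ hμ x‖ :=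
  rfl

/-- The extrapolation space `X₋₁`: the completion of `X` for the norm `‖x‖₋₁ = ‖R(μ, A) x‖`. -/
abbrev Extrapolation (A : X →ₗ.[ℂ] X) (μ : ℂ) (hμ : μ ∈ resolventSet A) : Type _ :=
  UniformSpace.Completion (PreExtrapolation A μ hμ)

/-- The canonical embedding `X → X₋₁`. -/
def embed (A : X →ₗ.[ℂ] X) (μ : ℂ) (hμ : μ ∈ resolventSet A) :
    X →ₗ[ℂ] Extrapolation A μ hμ :=
  (UniformSpace.Completion.toComplₗᵢ (𝕜 := ℂ) (E := PreExtrapolation A μ hμ)).toLinearMap ∘ₗ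
    (toPre A μ hμ).toLinearMap

end UnboundedOperator

open UnboundedOperator

/-! ### Strongly continuous semigroups -/

/-- A `C₀`-semigroup of bounded operators on `X`. -/
structure C0Semigroup (X : Type*) [NormedAddCommGroup X] [NormedSpace ℂ X] where
  /-- The operators `T(t)`, `t ≥ 0`. -/
  T : ℝ≥0 → X →L[ℂ] X
  map_zero : T 0 = ContinuousLinearMap.id ℂ X
  map_add : ∀ s t : ℝ≥0, T (s + t) = (T s).comp (T t)
  continuous_orbit : ∀ x : X, Continuous fun t : ℝ≥0 => T t x

namespace C0Semigroup

variable {X : Type*} [NormedAddCommGroup X] [NormedSpace ℂ X]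

/-- `y = lim_{t ↓ 0} (T(t) x - x) / t`. -/
def HasGeneratorAt (S : C0Semigroup X) (x y : X) : Prop :=
  Tendsto (fun t : ℝ≥0 => ((t : ℝ) : ℂ)⁻¹ • (S.T t x - x)) (𝓝[>] 0) (𝓝 y)

theorem HasGeneratorAt.unique {S : C0Semigroup X} {x y z : X} (hy : S.HasGeneratorAt x y)
    (hz : S.HasGeneratorAt x z) : y = z :=
  tendsto_nhds_unique hy hz

theorem HasGeneratorAt.add {S : C0Semigroup X} {x x' y y' : X} (h : S.HasGeneratorAt x y)
    (h' : S.HasGeneratorAt x' y') : S.HasGeneratorAt (x + x') (y + y') := by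
  refine (Tendsto.add h h').congr fun t => ?_
  rw [← smul_add, _root_.map_add]
  congr 1
  abel

theorem HasGeneratorAt.smul {S : C0Semigroup X} {x y : X} (c : ℂ) (h : S.HasGeneratorAt x y) :
    S.HasGeneratorAt (c • x) (c • y) := by
  refine (Tendsto.const_smul h c).congr fun t => ?_
  rw [smul_comm, _root_.map_smul, smul_sub]

theorem HasGeneratorAt.zero (S : C0Semigroup X) : S.HasGeneratorAt 0 0 := by
  simp [HasGeneratorAt]

/-- The generator `A` of the semigroup: `D(A)` consists of the `x` for which
`lim_{t ↓ 0} (T(t) x - x) / t` exists, and `A x` is this limit. -/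
def generator (S : C0Semigroup X) : X →ₗ.[ℂ] X where
  domain :=
    { carrier := {x | ∃ y, S.HasGeneratorAt x y}
      add_mem' := fun ⟨_, ha⟩ ⟨_, hb⟩ => ⟨_, ha.add hb⟩
      zero_mem' := ⟨0, HasGeneratorAt.zero S⟩
      smul_mem' := fun c _ ⟨_, hx⟩ => ⟨_, hx.smul c⟩ }
  toFun :=
    { toFun := fun x => Classical.choose x.2
      map_add' := fun x y => HasGeneratorAt.unique (Classical.choose_spec (x + y).2)
        ((Classical.choose_spec x.2).add (Classical.choose_spec y.2))
      map_smul' := fun c x => HasGeneratorAt.unique (Classical.choose_spec (c • x).2)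
        ((Classical.choose_spec x.2).smul c) }

theorem hasGeneratorAt_generator (S : C0Semigroup X) (x : S.generator.domain) :
    S.HasGeneratorAt x (S.generator x) :=
  Classical.choose_spec x.2

theorem HasGeneratorAt.apply {S : C0Semigroup X} {x y : X} (h : S.HasGeneratorAt x y) (t : ℝ≥0) :
    S.HasGeneratorAt (S.T t x) (S.T t y) := by
  refine (((S.T t).continuous.tendsto y).comp h).congr fun s => ?_
  have : S.T s (S.T t x) = S.T t (S.T s x) := by
    rw [← ContinuousLinearMap.comp_apply, ← ContinuousLinearMap.comp_apply, ← S.map_add,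
      ← S.map_add, add_comm]
  simp [this, map_sub]

theorem resolvent_comm (S : C0Semigroup X) (μ : ℂ) (hμ : μ ∈ resolventSet S.generator)
    (t : ℝ≥0) (x : X) :
    resolvent S.generator μ hμ (S.T t x) = S.T t (resolvent S.generator μ hμ x) := by
  obtain ⟨h, e⟩ := (isResolvent_resolvent S.generator μ hμ).1 x
  have hg := (S.hasGeneratorAt_generator ⟨_, h⟩).apply t
  have hd : S.T t (resolvent S.generator μ hμ x) ∈ S.generator.domain := ⟨_, hg⟩
  have e' := (isResolvent_resolvent S.generator μ hμ).2 ⟨_, hd⟩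
  rw [(S.hasGeneratorAt_generator ⟨_, hd⟩).unique hg] at e'
  simp only at e'
  rwa [← _root_.map_smul, ← map_sub, e] at e'

/-- The semigroup is exponentially stable: `‖T(t)‖ ≤ M e^{-ωt}` for some `M, ω > 0`. -/
def IsExponentiallyStable (S : C0Semigroup X) : Prop :=
  ∃ M > (0 : ℝ), ∃ ω > (0 : ℝ), ∀ t : ℝ≥0, ‖S.T t‖ ≤ M * Real.exp (-ω * t)

/-- The open sector `{z ≠ 0 : |arg z| < δ}`. -/
def sector (δ : ℝ) : Set ℂ := {z | z ≠ 0 ∧ |z.arg| < δ}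

/-- The semigroup is analytic: it extends to a holomorphic family of bounded operators on an open
sector around the positive half-line, which satisfies the semigroup law there and is strongly
continuous at `0`. -/
def IsAnalytic (S : C0Semigroup X) : Prop :=
  ∃ δ : ℝ, 0 < δ ∧ δ ≤ Real.pi / 2 ∧ ∃ F : ℂ → X →L[ℂ] X,
    (∀ t : ℝ≥0, F ((t : ℝ) : ℂ) = S.T t) ∧
    DifferentiableOn ℂ F (sector δ) ∧
    (∀ z ∈ sector δ, ∀ w ∈ sector δ, F (z + w) = (F z).comp (F w)) ∧
    ∀ x : X, Tendsto (fun z => F z x) (𝓝[sector δ] 0) (𝓝 x)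

/-! ### The extrapolated semigroup -/

/-- The operator `T(t)` on the copy of `X` with the norm `‖·‖₋₁`. -/
def preExtrapolated (S : C0Semigroup X) (μ : ℂ) (hμ : μ ∈ resolventSet S.generator) (t : ℝ≥0) :
    PreExtrapolation S.generator μ hμ →L[ℂ] PreExtrapolation S.generator μ hμ :=
  LinearMap.mkContinuous
    ((toPre S.generator μ hμ).toLinearMap ∘ₗ (S.T t).toLinearMap ∘ₗ
      (toPre S.generator μ hμ).symm.toLinearMap)
    ‖S.T t‖ (fun x => by
      obtain ⟨x, rfl⟩ := (toPre S.generator μ hμ).surjective x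
      simp only [LinearMap.comp_apply, LinearEquiv.coe_coe, LinearEquiv.symm_apply_apply,
        ContinuousLinearMap.coe_coe, norm_toPre, resolvent_comm]
      exact (S.T t).le_opNorm _)

/-- The operator `T₋₁(t)` on `X₋₁`: the continuous extension of `T(t)`. -/
def extrapolated (S : C0Semigroup X) (μ : ℂ) (hμ : μ ∈ resolventSet S.generator) (t : ℝ≥0) :
    Extrapolation S.generator μ hμ →L[ℂ] Extrapolation S.generator μ hμ :=
  (S.preExtrapolated μ hμ t).completion

/-! ### Input operators and admissibility

`U` is regarded as a real Banach space and `B` only has to be real-linear; a complex Banach space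
`U` with a complex-linear `B` is a special case. -/

variable {U : Type*} [NormedAddCommGroup U] [NormedSpace ℝ U]
  (S : C0Semigroup X) {μ : ℂ} {hμ : μ ∈ resolventSet S.generator}

/-- The input operators `Φ_τ u = ∫_0^τ T₋₁(τ - s) B u(s) ds ∈ X₋₁`, for `τ ≥ 0`. -/
def inputMap (B : U →L[ℝ] Extrapolation S.generator μ hμ) (τ : ℝ) (u : ℝ → U) :
    Extrapolation S.generator μ hμ :=
  ∫ s in (0 : ℝ)..τ, S.extrapolated μ hμ (τ - s).toNNReal (B (u s))

/-- The `X₋₁`-valued function `τ ↦ Φ_τ u` on `[0, t]` takes values in `X` almost everywhere and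
coincides a.e. with the `X`-valued function `x`. -/
def IsTrajectory (B : U →L[ℝ] Extrapolation S.generator μ hμ) (t : ℝ) (u : ℝ → U)
    (x : ℝ → X) : Prop :=
  ∀ᵐ τ ∂(volume.restrict (Set.Icc 0 t)), S.inputMap B τ u = embed S.generator μ hμ (x τ)

/-- Finite-time `L^p`-`L^q`-admissibility of `Σ(A,B)`: for some `t > 0`, every `u ∈ L^p([0,t],U)`
satisfies `Φ_{(·)} u ∈ L^q([0,t],X)`. -/
def IsAdmissible (B : U →L[ℝ] Extrapolation S.generator μ hμ) (p q : ℝ≥0∞) : Prop :=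
  ∃ t : ℝ, 0 < t ∧ ∀ u : ℝ → U, MemLp u p (volume.restrict (Set.Icc 0 t)) →
    ∃ x : ℝ → X, S.IsTrajectory B t u x ∧ MemLp x q (volume.restrict (Set.Icc 0 t))

/-- Infinite-time `L^p`-`L^q`-admissibility of `Σ(A,B)`: it is finite-time admissible, and
`‖Φ_{(·)} u‖_{L^q([0,t],X)} ≤ c ‖u‖_{L^p([0,t],U)}` with a constant `c` independent of `t > 0`. -/
def IsInfiniteTimeAdmissible (B : U →L[ℝ] Extrapolation S.generator μ hμ) (p q : ℝ≥0∞) : Prop :=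
  S.IsAdmissible B p q ∧
    ∃ c : ℝ≥0, ∀ t : ℝ, 0 < t → ∀ u : ℝ → U, MemLp u p (volume.restrict (Set.Icc 0 t)) →
      ∃ x : ℝ → X, S.IsTrajectory B t u x ∧ MemLp x q (volume.restrict (Set.Icc 0 t)) ∧
        eLpNorm x q (volume.restrict (Set.Icc 0 t)) ≤
          c * eLpNorm u p (volume.restrict (Set.Icc 0 t))

end C0Semigroup

end

/-!
The state at time `τ` is the contribution of the recent inputs plus the free evolution of an earlier
state. Fix `h > 0` such that the system is admissible on `[0, 2h]`, and for `τ ∈ [kh, (k+1)h)` split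
the past at `(k-1)h`:
`Φ_τ u = ∫_{(k-1)h}^τ T₋₁(τ - s) B u(s) ds + T₋₁(τ - (k-1)h) Φ_{(k-1)h} u`.

* The first term is, by time invariance, a trajectory on `[0, 2h]`. Admissibility gives a constant
  `K` bounding trajectories by inputs in `L^p([0, 2h])` through the closed graph theorem
  (`exists_bound_of_forall_exists_isTrajectory`). Every point lies in only two of the windows
  `[(k-1)h, (k+1)h)`, so summing the `p`-th powers over `k` costs a factor `2^{1/p}`
  (`eLpNorm_piecewise_floor_le`).
* The second term starts from a state that is only in `X₋₁`, but it has evolved for a time at least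
  `h`. An analytic semigroup is norm differentiable at `h > 0`, so
  `T(h) = (μ - A) T(h) R(μ, A)` with `(μ - A) T(h)` bounded, and `T₋₁(h)` is bounded from `X₋₁` to
  `X` (`IsAnalytic.exists_smoothing`). By exponential stability the norm of `Φ_{(k-1)h} u` in `X₋₁` is
  at most a constant times the convolution of `‖u‖` with `e^{-ωr}`, `r ≥ 0`
  (`enorm_inputMap_le`), and Young's inequality for a finite measure
  (`eLpNorm_lintegral_sub_le`) bounds this in `L^p`.

Extending the input by zero, every horizon is treated at once on the whole line
(`exists_halfLine_bound`).
-/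

/-! ### The embedding into the extrapolation space -/

namespace UnboundedOperator

variable {X : Type*} [NormedAddCommGroup X] [NormedSpace ℂ X]
  (A : X →ₗ.[ℂ] X) (μ : ℂ) (hμ : μ ∈ resolventSet A)

theorem norm_embed (x : X) : ‖embed A μ hμ x‖ = ‖resolvent A μ hμ x‖ :=
  (UniformSpace.Completion.norm_coe _).trans (norm_toPre A μ hμ x)

theorem embed_injective : Function.Injective (embed A μ hμ) := by
  refine (injective_iff_map_eq_zero _).2 fun x hx => ?_
  have h : resolvent A μ hμ x = 0 := by rw [← norm_eq_zero, ← norm_embed, hx, norm_zero]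
  exact resolvent_injective A μ hμ (h.trans (map_zero _).symm)

theorem continuous_embed : Continuous (embed A μ hμ) :=
  AddMonoidHomClass.continuous_of_bound (embed A μ hμ) ‖resolvent A μ hμ‖ fun x => by
    rw [norm_embed]
    exact (resolvent A μ hμ).le_opNorm x

theorem denseRange_embed : DenseRange (embed A μ hμ) :=
  (UniformSpace.Completion.denseRange_coe (α := PreExtrapolation A μ hμ)).comp
    (toPre A μ hμ).surjective.denseRange (UniformSpace.Completion.continuous_coe _)

end UnboundedOperator

open UnboundedOperator

/-! ### The extrapolated semigroup -/

namespace C0Semigroup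

variable {X : Type*} [NormedAddCommGroup X] [NormedSpace ℂ X]
  (S : C0Semigroup X) (μ : ℂ) (hμ : μ ∈ resolventSet S.generator)

theorem extrapolated_embed (t : ℝ≥0) (x : X) :
    S.extrapolated μ hμ t (embed S.generator μ hμ x) = embed S.generator μ hμ (S.T t x) :=
  ContinuousLinearMap.completion_apply_coe (S.preExtrapolated μ hμ t) (toPre S.generator μ hμ x)

theorem norm_extrapolated_apply_le (t : ℝ≥0) (y : Extrapolation S.generator μ hμ) :
    ‖S.extrapolated μ hμ t y‖ ≤ ‖S.T t‖ * ‖y‖ := by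
  refine (denseRange_embed S.generator μ hμ).induction_on y
    (isClosed_le (by fun_prop) (by fun_prop)) fun x => ?_
  rw [extrapolated_embed, norm_embed, norm_embed, resolvent_comm]
  exact (S.T t).le_opNorm _

theorem extrapolated_add (s t : ℝ≥0) (y : Extrapolation S.generator μ hμ) :
    S.extrapolated μ hμ (s + t) y = S.extrapolated μ hμ s (S.extrapolated μ hμ t y) := by
  refine (denseRange_embed S.generator μ hμ).induction_on y
    (isClosed_eq (by fun_prop) (by fun_prop)) fun x => ?_
  simp only [extrapolated_embed, S.map_add, ContinuousLinearMap.comp_apply]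

/-- For a bounded semigroup the extrapolated semigroup is jointly continuous: it is uniformly
Lipschitz, and its orbits through the dense subspace `X` are continuous. -/
theorem continuous_extrapolated {M : ℝ≥0} (hM : ∀ t, ‖S.T t‖ ≤ M) :
    Continuous fun q : Extrapolation S.generator μ hμ × ℝ≥0 => S.extrapolated μ hμ q.2 q.1 := by
  refine continuous_prod_of_dense_continuous_lipschitzWith _ M
    (denseRange_embed S.generator μ hμ) ?_ ?_
  rotate_left
  · intro t
    refine LipschitzWith.of_dist_le_mul fun y z => ?_
    rw [dist_eq_norm, dist_eq_norm, ← map_sub]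
    exact (S.norm_extrapolated_apply_le μ hμ t _).trans (by gcongr; exact hM t)
  · rintro _ ⟨x, rfl⟩
    simp only [extrapolated_embed]
    exact (continuous_embed S.generator μ hμ).comp (S.continuous_orbit x)

theorem norm_le_of_norm_le_exp {S : C0Semigroup X} {M : ℝ≥0} {ω : ℝ} (hω : 0 < ω)
    (hM : ∀ r : ℝ≥0, ‖S.T r‖ ≤ M * Real.exp (-ω * r)) (r : ℝ≥0) : ‖S.T r‖ ≤ M :=
  (hM r).trans <| mul_le_of_le_one_right M.2 <| Real.exp_le_one_iff.2 <|
    mul_nonpos_of_nonpos_of_nonneg (neg_nonpos.2 hω.le) r.2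

/-! ### Smoothing by analytic semigroups -/

variable {S} in
/-- An analytic semigroup is norm differentiable at positive times, so it maps `X` into the domain
of its generator. -/
theorem IsAnalytic.exists_hasGeneratorAt (h : S.IsAnalytic) {t : ℝ≥0}
    (ht : 0 < t) : ∃ D : X →L[ℂ] X, ∀ x, S.HasGeneratorAt (S.T t x) (D x) := by
  obtain ⟨δ, hδ, hδ', F, hF, hd, -, -⟩ := h
  have hs : sector δ ∈ 𝓝 ((t : ℝ) : ℂ) := by
    have hslit : ((t : ℝ) : ℂ) ∈ Complex.slitPlane := by simp [ht]
    have h0 : |Complex.arg ((t : ℝ) : ℂ)| < δ := by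
      rwa [Complex.arg_ofReal_of_nonneg t.coe_nonneg, abs_zero]
    have h1 : ∀ᶠ z in 𝓝 ((t : ℝ) : ℂ), |z.arg| < δ :=
      (continuous_abs.continuousAt.comp (Complex.continuousAt_arg hslit)).eventually_lt_const h0
    filter_upwards [h1, Complex.isOpen_slitPlane.mem_nhds hslit] with z hz hz'
    exact ⟨Complex.slitPlane_ne_zero hz', hz⟩
  have hD := (hd.differentiableAt hs).hasDerivAt
  refine ⟨deriv F (t : ℝ), fun x => ?_⟩
  have hx : Tendsto (fun z : ℂ => z⁻¹ • (F ((t : ℝ) + z) x - F (t : ℝ) x)) (𝓝[≠] 0)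
      (𝓝 (deriv F (t : ℝ) x)) := by
    have := (ContinuousLinearMap.apply ℂ X x).continuous.continuousAt.tendsto.comp
      (hasDerivAt_iff_tendsto_slope_zero.1 hD)
    refine this.congr fun z => ?_
    simp
  have hi : Tendsto (fun s : ℝ≥0 => ((s : ℝ) : ℂ)) (𝓝[>] 0) (𝓝[≠] 0) := by
    refine tendsto_nhdsWithin_iff.2 ⟨?_, ?_⟩
    · have : Continuous fun s : ℝ≥0 => ((s : ℝ) : ℂ) := by fun_prop
      simpa using (this.tendsto 0).mono_left nhdsWithin_le_nhds
    · filter_upwards [self_mem_nhdsWithin] with s hs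
      simpa using (ne_of_gt hs)
  refine (hx.comp hi).congr fun s => ?_
  have e : F ((t : ℝ) + (s : ℝ)) = S.T (s + t) := by
    rw [← hF, NNReal.coe_add, add_comm, Complex.ofReal_add]
  simp only [Function.comp_apply]
  rw [e, hF, S.map_add, ContinuousLinearMap.comp_apply]

variable {S} in
/-- For `t > 0` an analytic semigroup satisfies `T(t) = (μ - A) T(t) R(μ, A)` with
`(μ - A) T(t)` bounded, so `T₋₁(t)` is bounded from `X₋₁` to `X`. -/
theorem IsAnalytic.exists_smoothing [CompleteSpace X] (h : S.IsAnalytic)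
    {t : ℝ≥0} (ht : 0 < t) :
    ∃ L : Extrapolation S.generator μ hμ →L[ℂ] X,
      ∀ y, embed S.generator μ hμ (L y) = S.extrapolated μ hμ t y := by
  obtain ⟨D, hD⟩ := h.exists_hasGeneratorAt ht
  set C := μ • S.T t - D
  have key : ∀ x, S.T t x = C (resolvent S.generator μ hμ x) := by
    intro x
    refine resolvent_injective S.generator μ hμ ?_
    set r := resolvent S.generator μ hμ x
    have hd : S.T t r ∈ S.generator.domain := ⟨_, hD r⟩
    have e : S.generator ⟨_, hd⟩ = D r := (S.hasGeneratorAt_generator ⟨_, hd⟩).unique (hD r)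
    have := (isResolvent_resolvent S.generator μ hμ).2 ⟨_, hd⟩
    rw [e] at this
    rw [resolvent_comm]
    exact this.symm
  let L₀ : PreExtrapolation S.generator μ hμ →L[ℂ] X :=
    LinearMap.mkContinuous ((S.T t).toLinearMap ∘ₗ (toPre S.generator μ hμ).symm.toLinearMap)
      ‖C‖ fun x => by
        obtain ⟨x, rfl⟩ := (toPre S.generator μ hμ).surjective x
        simp only [LinearMap.comp_apply, LinearEquiv.coe_coe, LinearEquiv.symm_apply_apply,
          ContinuousLinearMap.coe_coe, norm_toPre, key]
        exact C.le_opNorm _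
  let L := L₀.extend (UniformSpace.Completion.toComplL (𝕜 := ℂ))
  have hL : ∀ x, L (embed S.generator μ hμ x) = S.T t x := fun x =>
    ContinuousLinearMap.extend_eq L₀ UniformSpace.Completion.denseRange_coe
      (UniformSpace.Completion.isUniformInducing_coe _) (toPre S.generator μ hμ x)
  refine ⟨L, fun y => ?_⟩
  refine (denseRange_embed S.generator μ hμ).induction_on y
    (isClosed_eq ((continuous_embed _ _ _).comp L.continuous) (by fun_prop)) fun x => ?_
  rw [hL, extrapolated_embed]

end C0Semigroup

/-! ### The input maps -/

namespace C0Semigroup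

variable {X : Type*} [NormedAddCommGroup X] [NormedSpace ℂ X]
  {U : Type*} [NormedAddCommGroup U] [NormedSpace ℝ U]
  (S : C0Semigroup X) {μ : ℂ} {hμ : μ ∈ resolventSet S.generator}
  (B : U →L[ℝ] Extrapolation S.generator μ hμ)

theorem norm_inputMap_integrand_le {M : ℝ} {r : ℝ≥0} (hM : ‖S.T r‖ ≤ M) (v : U) :
    ‖S.extrapolated μ hμ r (B v)‖ ≤ M * ‖B‖ * ‖v‖ := by
  refine (S.norm_extrapolated_apply_le μ hμ _ _).trans ?_
  rw [mul_assoc]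
  exact mul_le_mul hM (B.le_opNorm v) (norm_nonneg _) ((norm_nonneg _).trans hM)

theorem integrable_inputMap_integrand {M : ℝ≥0} (hM : ∀ t, ‖S.T t‖ ≤ M) {m : Measure ℝ}
    {u : ℝ → U} (hu : Integrable u m) (τ : ℝ) :
    Integrable (fun s => S.extrapolated μ hμ (τ - s).toNNReal (B (u s))) m := by
  refine (hu.norm.const_mul (M * ‖B‖)).mono' ?_
    (Eventually.of_forall fun s => S.norm_inputMap_integrand_le B (hM _) _)
  refine (S.continuous_extrapolated μ hμ hM).comp_aestronglyMeasurable
    (f := fun s => (B (u s), (τ - s).toNNReal)) ?_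
  refine (B.continuous.comp_aestronglyMeasurable hu.1).prodMk ?_
  exact (show Continuous fun s : ℝ => (τ - s).toNNReal by fun_prop).aestronglyMeasurable

theorem inputMap_congr_ae {t τ : ℝ} (hτ : τ ∈ Set.Icc 0 t) {u v : ℝ → U}
    (h : u =ᵐ[volume.restrict (Set.Icc 0 t)] v) : S.inputMap B τ u = S.inputMap B τ v := by
  refine intervalIntegral.integral_congr_ae_restrict ?_
  rw [Set.uIoc_of_le hτ.1]
  filter_upwards [ae_restrict_of_ae_restrict_of_subset
    (Set.Ioc_subset_Icc_self.trans (Set.Icc_subset_Icc_right hτ.2)) h] with s hs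
  rw [hs]

theorem intervalIntegrable_inputMap_integrand {M : ℝ≥0} (hM : ∀ t, ‖S.T t‖ ≤ M) {t τ : ℝ}
    (hτ : τ ∈ Set.Icc 0 t) {u : ℝ → U} (hu : IntegrableOn u (Set.Icc 0 t)) :
    IntervalIntegrable (fun s => S.extrapolated μ hμ (τ - s).toNNReal (B (u s))) volume 0 τ := by
  rw [intervalIntegrable_iff, Set.uIoc_of_le hτ.1]
  exact S.integrable_inputMap_integrand B hM (hu.mono_set
    (Set.Ioc_subset_Icc_self.trans (Set.Icc_subset_Icc_right hτ.2))) τ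

theorem inputMap_add {M : ℝ≥0} (hM : ∀ t, ‖S.T t‖ ≤ M) {t τ : ℝ} (hτ : τ ∈ Set.Icc 0 t)
    {u v : ℝ → U} (hu : IntegrableOn u (Set.Icc 0 t)) (hv : IntegrableOn v (Set.Icc 0 t)) :
    S.inputMap B τ (u + v) = S.inputMap B τ u + S.inputMap B τ v := by
  simp only [inputMap]
  rw [← intervalIntegral.integral_add (S.intervalIntegrable_inputMap_integrand B hM hτ hu)
    (S.intervalIntegrable_inputMap_integrand B hM hτ hv)]
  simp only [Pi.add_apply, _root_.map_add]

theorem inputMap_smul (c : ℝ) (τ : ℝ) (u : ℝ → U) :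
    S.inputMap B τ (c • u) = c • S.inputMap B τ u := by
  simp only [inputMap]
  rw [← intervalIntegral.integral_smul]
  refine intervalIntegral.integral_congr fun s _ => ?_
  simp only [Pi.smul_apply, _root_.map_smul]
  exact ((S.extrapolated μ hμ (τ - s).toNNReal).restrictScalars ℝ).map_smul c (B (u s))

theorem inputMap_sub {M : ℝ≥0} (hM : ∀ t, ‖S.T t‖ ≤ M) {t τ : ℝ} (hτ : τ ∈ Set.Icc 0 t)
    {u v : ℝ → U} (hu : IntegrableOn u (Set.Icc 0 t)) (hv : IntegrableOn v (Set.Icc 0 t)) :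
    S.inputMap B τ (u - v) = S.inputMap B τ u - S.inputMap B τ v := by
  simp only [inputMap]
  rw [← intervalIntegral.integral_sub (S.intervalIntegrable_inputMap_integrand B hM hτ hu)
    (S.intervalIntegrable_inputMap_integrand B hM hτ hv)]
  simp only [Pi.sub_apply, _root_.map_sub]

theorem norm_inputMap_le {M : ℝ≥0} (hM : ∀ t, ‖S.T t‖ ≤ M) {t τ : ℝ} (hτ : τ ∈ Set.Icc 0 t)
    {u : ℝ → U} (hu : IntegrableOn u (Set.Icc 0 t)) :
    ‖S.inputMap B τ u‖ ≤ M * ‖B‖ * ∫ s in Set.Icc 0 t, ‖u s‖ := by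
  rw [inputMap, intervalIntegral.integral_of_le hτ.1, ← integral_const_mul]
  have hsub : Set.Ioc 0 τ ⊆ Set.Icc 0 t :=
    Set.Ioc_subset_Icc_self.trans (Set.Icc_subset_Icc_right hτ.2)
  refine (norm_integral_le_of_norm_le ((hu.mono_set hsub).norm.const_mul (M * ‖B‖))
    (Eventually.of_forall fun s => S.norm_inputMap_integrand_le B (hM _) _)).trans ?_
  exact setIntegral_mono_set (hu.norm.const_mul _)
    (Eventually.of_forall fun s => by dsimp; positivity) hsub.eventuallyLE

/-- For an input vanishing on the negative half-line, the state is the integral over the whole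
past, at negative times as well. -/
theorem inputMap_eq_setIntegral {u : ℝ → U} (hu₀ : ∀ s < 0, u s = 0) (τ : ℝ) :
    S.inputMap B τ u =
      ∫ s in Set.Iic τ, S.extrapolated μ hμ (τ - s).toNNReal (B (u s)) := by
  have hz : ∀ s < 0, S.extrapolated μ hμ (τ - s).toNNReal (B (u s)) = 0 := fun s hs => by
    rw [hu₀ s hs, _root_.map_zero, _root_.map_zero]
  rcases le_or_gt 0 τ with h | h
  · rw [inputMap, intervalIntegral.integral_of_le h, ← integral_Icc_eq_integral_Ioc]
    refine (setIntegral_eq_of_subset_of_forall_sdiff_eq_zero measurableSet_Iic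
      Set.Icc_subset_Iic_self fun s hs => hz s ?_).symm
    by_contra hs'
    exact hs.2 ⟨not_lt.1 hs', hs.1⟩
  · rw [setIntegral_eq_zero_of_forall_eq_zero fun s hs =>
      hz s ((Set.mem_Iic.1 hs).trans_lt h), inputMap]
    refine intervalIntegral.integral_zero_ae ?_
    rw [Set.uIoc_of_ge h.le]
    filter_upwards [compl_mem_ae_iff.2 (measure_singleton (0 : ℝ))] with s hs hs'
    exact hz s (lt_of_le_of_ne hs'.2 hs)

/-- Splitting the past of `τ` at an earlier time `a`. -/
theorem inputMap_eq_add {M : ℝ≥0} (hM : ∀ t, ‖S.T t‖ ≤ M) {u : ℝ → U} (hu : Integrable u)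
    (hu₀ : ∀ s < 0, u s = 0) {a τ : ℝ} (h : a ≤ τ) :
    S.inputMap B τ u = S.inputMap B (τ - a) (fun s => u (s + a)) +
      S.extrapolated μ hμ (τ - a).toNNReal (S.inputMap B a u) := by
  have hi := S.integrable_inputMap_integrand B hM hu τ
  rw [S.inputMap_eq_setIntegral B hu₀, S.inputMap_eq_setIntegral B hu₀ a,
    ← Set.Iic_union_Ioc_eq_Iic h, setIntegral_union (Set.Iic_disjoint_Ioc le_rfl)
      measurableSet_Ioc hi.integrableOn hi.integrableOn, add_comm]
  congr 1
  · rw [inputMap, ← intervalIntegral.integral_of_le h]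
    have := intervalIntegral.integral_comp_add_right (a := 0) (b := τ - a)
      (fun s => S.extrapolated μ hμ (τ - s).toNNReal (B (u s))) a
    rw [zero_add, sub_add_cancel] at this
    rw [← this]
    simp only [sub_sub, add_comm]
  · rw [← ContinuousLinearMap.integral_comp_comm _
      (S.integrable_inputMap_integrand B hM hu a).integrableOn]
    refine setIntegral_congr_fun measurableSet_Iic fun s hs => ?_
    have hs : s ≤ a := hs
    rw [← extrapolated_add, ← Real.toNNReal_add (sub_nonneg.2 h) (sub_nonneg.2 hs)]
    congr 3
    ring

/-- The measure on `[0, ∞)` with density `e^{-ωr}`. -/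
noncomputable def expMeasure (ω : ℝ) : Measure ℝ :=
  (volume.restrict (Set.Ici 0)).withDensity fun r => ENNReal.ofReal (Real.exp (-ω * r))

theorem isFiniteMeasure_expMeasure {ω : ℝ} (hω : 0 < ω) : IsFiniteMeasure (expMeasure ω) := by
  refine isFiniteMeasure_withDensity_ofReal (Integrable.hasFiniteIntegral ?_)
  exact (integrableOn_Ici_iff_integrableOn_Ioi (by simp)).2 (exp_neg_integrableOn_Ioi 0 hω)

/-- The state at time `a` in the norm of `X₋₁` is controlled by the exponentially weighted past of
the input at any later time. -/
theorem enorm_inputMap_le {M ω : ℝ} (hM : ∀ t : ℝ≥0, ‖S.T t‖ ≤ M * Real.exp (-ω * t))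
    {u : ℝ → U} (hum : StronglyMeasurable u) (hu₀ : ∀ s < 0, u s = 0) {a τ : ℝ} (h : a ≤ τ) :
    ‖S.inputMap B a u‖ₑ ≤ ENNReal.ofReal (M * ‖B‖ * Real.exp (ω * (τ - a))) *
      ∫⁻ r, ‖u (τ - r)‖ₑ ∂(expMeasure ω) := by
  have hM0 : 0 ≤ M := nonneg_of_mul_nonneg_left ((norm_nonneg _).trans (hM 0)) (Real.exp_pos _)
  have hum' : Measurable fun s => ‖u s‖ₑ := hum.enorm
  have hmeas : Measurable fun r : ℝ => ENNReal.ofReal (Real.exp (-ω * r)) := by fun_prop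
  rw [S.inputMap_eq_setIntegral B hu₀]
  refine (enorm_integral_le_lintegral_enorm _).trans ?_
  have hpt : ∀ s ∈ Set.Iic a, ‖S.extrapolated μ hμ (a - s).toNNReal (B (u s))‖ₑ ≤
      ENNReal.ofReal (M * ‖B‖ * Real.exp (ω * (τ - a))) *
        (ENNReal.ofReal (Real.exp (-ω * (τ - s))) * ‖u s‖ₑ) := by
    intro s hs
    have hs : s ≤ a := hs
    rw [← mul_assoc, ← ENNReal.ofReal_mul (by positivity), ← ofReal_norm, ← ofReal_norm,
      ← ENNReal.ofReal_mul (by positivity)]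
    refine ENNReal.ofReal_le_ofReal ((S.norm_inputMap_integrand_le B (hM _) _).trans_eq ?_)
    rw [Real.coe_toNNReal _ (sub_nonneg.2 hs), mul_assoc (M * ‖B‖), ← Real.exp_add,
      mul_right_comm M]
    congr 3
    ring
  refine (setLIntegral_mono' measurableSet_Iic hpt).trans ?_
  rw [lintegral_const_mul _ (by fun_prop)]
  refine mul_le_mul_right ?_ _
  rw [expMeasure, lintegral_withDensity_eq_lintegral_mul _ hmeas
    (show Measurable fun r => ‖u (τ - r)‖ₑ from hum'.comp (measurable_const.sub measurable_id)), ← lintegral_indicator measurableSet_Iic,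
    ← lintegral_indicator measurableSet_Ici, ← lintegral_sub_left_eq_self _ τ]
  refine lintegral_mono fun r => ?_
  by_cases hr : τ - r ≤ a
  · rw [Set.indicator_of_mem (show τ - r ∈ Set.Iic a from hr),
      Set.indicator_of_mem (show r ∈ Set.Ici 0 by simp; linarith)]
    simp
  · rw [Set.indicator_of_notMem (show τ - r ∉ Set.Iic a from hr)]
    exact zero_le

end C0Semigroup

/-! ### The closed graph argument -/

namespace C0Semigroup

variable {X : Type*} [NormedAddCommGroup X] [NormedSpace ℂ X]
  {U : Type*} [NormedAddCommGroup U] [NormedSpace ℝ U]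
  {S : C0Semigroup X} {μ : ℂ} {hμ : μ ∈ resolventSet S.generator}
  {B : U →L[ℝ] Extrapolation S.generator μ hμ} {t : ℝ}

theorem IsTrajectory.ae_eq {u : ℝ → U} {x y : ℝ → X} (hx : S.IsTrajectory B t u x)
    (hy : S.IsTrajectory B t u y) : x =ᵐ[volume.restrict (Set.Icc 0 t)] y := by
  filter_upwards [hx, hy] with τ h₁ h₂
  exact embed_injective _ _ _ (h₁.symm.trans h₂)

theorem IsTrajectory.congr {u v : ℝ → U} {x y : ℝ → X} (h : S.IsTrajectory B t u x)
    (huv : u =ᵐ[volume.restrict (Set.Icc 0 t)] v)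
    (hxy : x =ᵐ[volume.restrict (Set.Icc 0 t)] y) : S.IsTrajectory B t v y := by
  filter_upwards [h, hxy, ae_restrict_mem measurableSet_Icc] with τ h₁ h₂ hτ
  rw [← h₂, ← h₁, S.inputMap_congr_ae B hτ huv]

theorem IsTrajectory.add {M : ℝ≥0} (hM : ∀ r, ‖S.T r‖ ≤ M) {u v : ℝ → U} {x y : ℝ → X}
    (hx : S.IsTrajectory B t u x) (hy : S.IsTrajectory B t v y)
    (hu : IntegrableOn u (Set.Icc 0 t)) (hv : IntegrableOn v (Set.Icc 0 t)) :
    S.IsTrajectory B t (u + v) (x + y) := by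
  filter_upwards [hx, hy, ae_restrict_mem measurableSet_Icc] with τ h₁ h₂ hτ
  rw [S.inputMap_add B hM hτ hu hv, h₁, h₂, Pi.add_apply, _root_.map_add]

theorem IsTrajectory.smul {u : ℝ → U} {x : ℝ → X} (hx : S.IsTrajectory B t u x) (c : ℝ) :
    S.IsTrajectory B t (c • u) (c • x) := by
  filter_upwards [hx] with τ h
  rw [inputMap_smul, h, Pi.smul_apply]
  exact (((embed S.generator μ hμ).restrictScalars ℝ).map_smul c (x τ)).symm

/-- On `Lᵖ` over a finite measure space the `L¹`-norm is bounded by the `Lᵖ`-norm. -/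
theorem exists_integral_norm_le {α E : Type*} [MeasurableSpace α] [NormedAddCommGroup E]
    (m : Measure α) [IsFiniteMeasure m] {p : ℝ≥0∞} (hp₁ : 1 ≤ p) :
    ∃ D : ℝ, ∀ f : Lp E p m, ∫ s, ‖f s‖ ∂m ≤ D * ‖f‖ := by
  refine ⟨(m Set.univ ^ (1 / (1 : ℝ≥0∞).toReal - 1 / p.toReal)).toReal, fun f => ?_⟩
  have h := eLpNorm_le_eLpNorm_mul_rpow_measure_univ hp₁ (Lp.aestronglyMeasurable f)
  have hexp : 0 ≤ 1 / (1 : ℝ≥0∞).toReal - 1 / p.toReal := by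
    by_cases hp : p = ⊤
    · simp [hp]
    · have : 1 ≤ p.toReal := by simpa using ENNReal.toReal_mono hp hp₁
      simpa using inv_le_one_of_one_le₀ this
  rw [integral_norm_eq_lintegral_enorm (Lp.aestronglyMeasurable f),
    ← eLpNorm_one_eq_lintegral_enorm, Lp.norm_def, mul_comm, ← ENNReal.toReal_mul]
  exact ENNReal.toReal_mono (ENNReal.mul_ne_top (Lp.eLpNorm_ne_top f)
    (ENNReal.rpow_ne_top_of_nonneg hexp (measure_ne_top _ _))) h

/-- If every input in `Lᵖ` has a trajectory in `Lᵖ`, then the closed graph theorem bounds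
trajectories by inputs: both `Lᵖ`-convergences imply convergence in `X₋₁` almost everywhere, along a
subsequence, and `X` embeds injectively into `X₋₁`. -/
theorem exists_bound_of_forall_exists_isTrajectory [CompleteSpace X] [CompleteSpace U] {M : ℝ≥0}
    (hM : ∀ r, ‖S.T r‖ ≤ M) {p : ℝ≥0∞} (hp₁ : 1 ≤ p)
    (h : ∀ u : ℝ → U, MemLp u p (volume.restrict (Set.Icc 0 t)) →
      ∃ x : ℝ → X, S.IsTrajectory B t u x ∧ MemLp x p (volume.restrict (Set.Icc 0 t))) :
    ∃ K : ℝ≥0, ∀ u : ℝ → U, MemLp u p (volume.restrict (Set.Icc 0 t)) →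
      ∃ x : ℝ → X, S.IsTrajectory B t u x ∧ MemLp x p (volume.restrict (Set.Icc 0 t)) ∧
        eLpNorm x p (volume.restrict (Set.Icc 0 t)) ≤
          K * eLpNorm u p (volume.restrict (Set.Icc 0 t)) := by
  have : Fact (1 ≤ p) := ⟨hp₁⟩
  set m := volume.restrict (Set.Icc 0 t)
  choose! x hx hmem using h
  have hint : ∀ u : Lp U p m, IntegrableOn u (Set.Icc 0 t) := fun u =>
    (Lp.memLp u).integrable hp₁
  have hG : ∀ u : Lp U p m, S.IsTrajectory B t u ((hmem u (Lp.memLp u)).toLp) := fun u =>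
    (hx u (Lp.memLp u)).congr EventuallyEq.rfl (MemLp.coeFn_toLp _).symm
  let G : Lp U p m →ₗ[ℝ] Lp X p m :=
    { toFun := fun u => (hmem u (Lp.memLp u)).toLp
      map_add' := fun u v => Lp.ext <| (hG (u + v)).ae_eq <|
        ((hG u).add hM (hG v) (hint u) (hint v)).congr (Lp.coeFn_add u v).symm
          (Lp.coeFn_add _ _).symm
      map_smul' := fun c u => Lp.ext <| (hG (c • u)).ae_eq <|
        ((hG u).smul c).congr (Lp.coeFn_smul c u).symm (Lp.coeFn_smul c _).symm }
  have hcont : Continuous G := by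
    refine G.continuous_of_seq_closed_graph fun u v y hu hy => ?_
    obtain ⟨ns, hns, hae⟩ := (tendstoInMeasure_of_tendsto_Lp hy).exists_seq_tendsto_ae
    have hGn : ∀ᵐ τ ∂m, ∀ n, S.inputMap B τ (u n) = embed S.generator μ hμ (G (u n) τ) :=
      ae_all_iff.2 fun n => hG (u n)
    have hΦ : ∀ τ ∈ Set.Icc 0 t, Tendsto (fun n => S.inputMap B τ (u n)) atTop
        (𝓝 (S.inputMap B τ v)) := by
      intro τ hτ
      obtain ⟨D, hD⟩ := exists_integral_norm_le (E := U) m hp₁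
      rw [tendsto_iff_norm_sub_tendsto_zero]
      have h0 : Tendsto (fun n => M * ‖B‖ * (D * ‖u n - v‖)) atTop (𝓝 0) := by
        simpa using ((tendsto_iff_norm_sub_tendsto_zero.1 hu).const_mul D).const_mul (M * ‖B‖)
      refine squeeze_zero (fun n => norm_nonneg _) (fun n => ?_) h0
      rw [← S.inputMap_sub B hM hτ (hint _) (hint _),
        ← S.inputMap_congr_ae B hτ (Lp.coeFn_sub (u n) v)]
      refine (S.norm_inputMap_le B hM hτ (hint _)).trans ?_
      gcongr
      exact hD _
    refine Lp.ext (IsTrajectory.ae_eq (B := B) (u := v) ?_ (hG v))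
    filter_upwards [hae, hGn, ae_restrict_mem measurableSet_Icc] with τ h₁ h₂ hτ
    refine tendsto_nhds_unique ((hΦ τ hτ).comp hns.tendsto_atTop) ?_
    refine (((continuous_embed S.generator μ hμ).tendsto _).comp h₁).congr fun n => ?_
    exact (h₂ (ns n)).symm
  let G' : Lp U p m →L[ℝ] Lp X p m := ⟨G, hcont⟩
  refine ⟨‖G'‖₊, fun u hu => ⟨G' (hu.toLp u), ?_, Lp.memLp _, ?_⟩⟩
  · exact (hG (hu.toLp u)).congr (MemLp.coeFn_toLp hu) EventuallyEq.rfl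
  · have h := G'.le_opENorm (hu.toLp u)
    rwa [Lp.enorm_def, Lp.enorm_def, eLpNorm_congr_ae (MemLp.coeFn_toLp hu)] at h

end C0Semigroup

/-! ### Young's inequality and gluing in Lᵖ -/

/-- Young's inequality for the convolution of a function with a finite measure. -/
theorem eLpNorm_lintegral_sub_le {p : ℝ≥0∞} (hp₁ : 1 ≤ p) (hp : p ≠ ⊤) (ν : Measure ℝ)
    [IsFiniteMeasure ν] {g : ℝ → ℝ≥0∞} (hg : Measurable g) :
    eLpNorm (fun τ => ∫⁻ r, g (τ - r) ∂ν) p volume ≤ ν Set.univ * eLpNorm g p volume := by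
  have hp0 : p ≠ 0 := (one_pos.trans_le hp₁).ne'
  have hpr : 0 < p.toReal := ENNReal.toReal_pos hp0 hp
  have hpr1 : 1 ≤ p.toReal := by simpa using ENNReal.toReal_mono hp hp₁
  have hgm : Measurable fun q : ℝ × ℝ => g (q.1 - q.2) := hg.comp (by fun_prop)
  -- Jensen's inequality for the measure `ν`
  have hJ : ∀ τ, (∫⁻ r, g (τ - r) ∂ν) ^ p.toReal ≤
      ν Set.univ ^ (p.toReal - 1) * ∫⁻ r, g (τ - r) ^ p.toReal ∂ν := by
    intro τ
    have h := eLpNorm_le_eLpNorm_mul_rpow_measure_univ (μ := ν) hp₁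
      (f := fun r => g (τ - r)) (hg.comp (by fun_prop)).aestronglyMeasurable
    rw [eLpNorm_one_eq_lintegral_enorm, eLpNorm_eq_lintegral_rpow_enorm_toReal hp0 hp] at h
    simp only [enorm_eq_self] at h
    refine (ENNReal.rpow_le_rpow h hpr.le).trans_eq ?_
    rw [ENNReal.mul_rpow_of_nonneg _ _ hpr.le, ← ENNReal.rpow_mul, ← ENNReal.rpow_mul, mul_comm]
    congr 2
    · simp; field_simp
    · rw [one_div, inv_mul_cancel₀ hpr.ne', ENNReal.rpow_one]
  have hI : ∫⁻ τ, (∫⁻ r, g (τ - r) ∂ν) ^ p.toReal ≤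
      ν Set.univ ^ p.toReal * ∫⁻ s, g s ^ p.toReal := by
    calc ∫⁻ τ, (∫⁻ r, g (τ - r) ∂ν) ^ p.toReal
        ≤ ∫⁻ τ, ν Set.univ ^ (p.toReal - 1) * ∫⁻ r, g (τ - r) ^ p.toReal ∂ν := lintegral_mono hJ
      _ = ν Set.univ ^ (p.toReal - 1) * ∫⁻ τ, ∫⁻ r, g (τ - r) ^ p.toReal ∂ν :=
        lintegral_const_mul _ (Measurable.lintegral_prod_right' (hgm.pow_const _))
      _ = ν Set.univ ^ (p.toReal - 1) * ∫⁻ r, (∫⁻ τ, g (τ - r) ^ p.toReal) ∂ν := by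
        rw [lintegral_lintegral_swap (hgm.pow_const _).aemeasurable]
      _ = ν Set.univ ^ (p.toReal - 1) * (ν Set.univ * ∫⁻ s, g s ^ p.toReal) := by
        simp_rw [lintegral_sub_right_eq_self (fun s => g s ^ p.toReal), lintegral_const]
        rw [mul_comm (ν Set.univ)]
      _ = ν Set.univ ^ p.toReal * ∫⁻ s, g s ^ p.toReal := by
        rw [← mul_assoc]
        congr 1
        conv_lhs => rw [← ENNReal.rpow_one (ν Set.univ), ← ENNReal.rpow_mul]
        rw [← ENNReal.rpow_add_of_nonneg _ _ (by simpa using hpr1) zero_le_one]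
        simp
  rw [eLpNorm_eq_lintegral_rpow_enorm_toReal hp0 hp, eLpNorm_eq_lintegral_rpow_enorm_toReal hp0 hp]
  simp only [enorm_eq_self]
  refine (ENNReal.rpow_le_rpow hI (by positivity)).trans_eq ?_
  rw [ENNReal.mul_rpow_of_nonneg _ _ (by positivity), ← ENNReal.rpow_mul,
    mul_one_div_cancel hpr.ne', ENNReal.rpow_one]

theorem mem_Ico_zsmul_iff {h : ℝ} (hh : 0 < h) (k : ℤ) (τ : ℝ) :
    τ ∈ Set.Ico (k • h) ((k + 1) • h) ↔ ⌊τ / h⌋ = k := by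
  rw [Int.floor_eq_iff, le_div_iff₀ hh, div_lt_iff₀ hh]
  simp [add_mul]

theorem lintegral_eq_tsum_Ico {h : ℝ} (hh : 0 < h) (f : ℝ → ℝ≥0∞) :
    ∫⁻ τ, f τ = ∑' k : ℤ, ∫⁻ τ in Set.Ico (k • h) ((k + 1) • h), f τ := by
  rw [← lintegral_iUnion (fun _ => measurableSet_Ico) (Set.pairwise_disjoint_Ico_zsmul h),
    iUnion_Ico_zsmul hh, Measure.restrict_univ]

/-- Gluing measurable functions along the partition of the line into intervals of length `h`. -/
theorem aestronglyMeasurable_piecewise_floor {E : Type*} [NormedAddCommGroup E] {h : ℝ}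
    (hh : 0 < h) {w : ℤ → ℝ → E}
    (hw : ∀ k : ℤ, AEStronglyMeasurable (w k)
      (volume.restrict (Set.Ico (k • h) ((k + 1) • h)))) :
    AEStronglyMeasurable (fun τ => w ⌊τ / h⌋ τ) volume := by
  rw [← Measure.restrict_univ (μ := volume), ← iUnion_Ico_zsmul hh]
  refine AEStronglyMeasurable.iUnion fun k => (hw k).congr ?_
  filter_upwards [ae_restrict_mem measurableSet_Ico] with τ hτ
  rw [(mem_Ico_zsmul_iff hh k τ).1 hτ]

theorem eLpNorm_rpow_toReal_eq_lintegral {α G : Type*} [MeasurableSpace α] [NormedAddCommGroup G]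
    {p : ℝ≥0∞} (hp0 : p ≠ 0) (hp : p ≠ ⊤) (f : α → G) (m : Measure α) :
    eLpNorm f p m ^ p.toReal = ∫⁻ s, ‖f s‖ₑ ^ p.toReal ∂m := by
  rw [eLpNorm_eq_lintegral_rpow_enorm_toReal hp0 hp, ← ENNReal.rpow_mul,
    one_div_mul_cancel (ENNReal.toReal_pos hp0 hp).ne', ENNReal.rpow_one]

/-- If a function is bounded in `Lᵖ` on each interval of length `h` by `u` on that interval and the
preceding one, then it is bounded by `u` on the line, since these windows cover the line twice. -/
theorem eLpNorm_piecewise_floor_le {E F : Type*} [NormedAddCommGroup E] [NormedAddCommGroup F]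
    {p : ℝ≥0∞} (hp₁ : 1 ≤ p) (hp : p ≠ ⊤) {h : ℝ} (hh : 0 < h) {w : ℤ → ℝ → E} {u : ℝ → F}
    {K : ℝ≥0∞}
    (hw : ∀ k : ℤ, eLpNorm (w k) p (volume.restrict (Set.Ico (k • h) ((k + 1) • h))) ≤
      K * eLpNorm u p (volume.restrict (Set.Icc ((k - 1) * h) ((k - 1) * h + 2 * h)))) :
    eLpNorm (fun τ => w ⌊τ / h⌋ τ) p volume ≤
      K * 2 ^ (1 / p.toReal) * eLpNorm u p volume := by
  have hp0 : p ≠ 0 := (one_pos.trans_le hp₁).ne'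
  have hpr : 0 < p.toReal := ENNReal.toReal_pos hp0 hp
  have hpowE (f : ℝ → E) := eLpNorm_rpow_toReal_eq_lintegral hp0 hp f
  have hpowF (f : ℝ → F) := eLpNorm_rpow_toReal_eq_lintegral hp0 hp f
  set q := p.toReal
  set I : ℤ → ℝ≥0∞ := fun k => ∫⁻ s in Set.Ico (k • h) ((k + 1) • h), ‖u s‖ₑ ^ q
  have hwin : ∀ k : ℤ, ∫⁻ s in Set.Icc (((k : ℝ) - 1) * h) ((k - 1) * h + 2 * h), ‖u s‖ₑ ^ q ≤
      I (k - 1) + I k := by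
    intro k
    rw [← restrict_Ico_eq_restrict_Icc]
    refine le_trans (le_of_eq ?_) (lintegral_union_le _ _ _)
    congr 2
    simp only [zsmul_eq_mul, sub_add_cancel]
    push_cast
    rw [Set.Ico_union_Ico_eq_Ico (by nlinarith) (by nlinarith)]
    congr 1
    ring
  have hloc : ∀ k : ℤ, ∫⁻ τ in Set.Ico (k • h) ((k + 1) • h), ‖w ⌊τ / h⌋ τ‖ₑ ^ q ≤
      K ^ q * (I (k - 1) + I k) := by
    intro k
    calc ∫⁻ τ in Set.Ico (k • h) ((k + 1) • h), ‖w ⌊τ / h⌋ τ‖ₑ ^ q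
        = ∫⁻ τ in Set.Ico (k • h) ((k + 1) • h), ‖w k τ‖ₑ ^ q :=
          setLIntegral_congr_fun measurableSet_Ico fun τ hτ => by
            simp only [(mem_Ico_zsmul_iff hh k τ).1 hτ]
      _ ≤ (K * eLpNorm u p
            (volume.restrict (Set.Icc ((k - 1) * h) ((k - 1) * h + 2 * h)))) ^ q := by
          rw [← hpowE]
          exact ENNReal.rpow_le_rpow (hw k) hpr.le
      _ ≤ K ^ q * (I (k - 1) + I k) := by
          rw [ENNReal.mul_rpow_of_nonneg _ _ hpr.le, hpowF]
          gcongr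
          exact hwin k
  have hsum : ∫⁻ τ, ‖w ⌊τ / h⌋ τ‖ₑ ^ q ≤ K ^ q * (2 * ∫⁻ s, ‖u s‖ₑ ^ q) := by
    rw [lintegral_eq_tsum_Ico hh, lintegral_eq_tsum_Ico hh (fun s => ‖u s‖ₑ ^ q)]
    refine (ENNReal.tsum_le_tsum hloc).trans_eq ?_
    have hshift : ∑' k, I (k - 1) = ∑' k, I k := (Equiv.subRight (1 : ℤ)).tsum_eq I
    rw [ENNReal.tsum_mul_left, ENNReal.tsum_add, hshift, two_mul]
  rw [← ENNReal.rpow_le_rpow_iff hpr, hpowE]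
  refine hsum.trans_eq ?_
  rw [ENNReal.mul_rpow_of_nonneg _ _ hpr.le, ENNReal.mul_rpow_of_nonneg _ _ hpr.le, hpowF,
    ← ENNReal.rpow_mul, one_div_mul_cancel hpr.ne', ENNReal.rpow_one, mul_assoc]

theorem measurePreserving_sub_restrict_Icc (a t : ℝ) :
    MeasurePreserving (fun s => s - a) (volume.restrict (Set.Icc a (a + t)))
      (volume.restrict (Set.Icc 0 t)) := by
  have := (measurePreserving_sub_right volume a).restrict_preimage
    (measurableSet_Icc (a := (0 : ℝ)) (b := t))
  rwa [Set.preimage_sub_const_Icc, zero_add, add_comm t] at this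

theorem measurePreserving_add_restrict_Icc (a t : ℝ) :
    MeasurePreserving (fun s => s + a) (volume.restrict (Set.Icc 0 t))
      (volume.restrict (Set.Icc a (a + t))) := by
  have := (measurePreserving_add_right volume a).restrict_preimage
    (measurableSet_Icc (a := a) (b := a + t))
  rwa [Set.preimage_add_const_Icc, sub_self, add_sub_cancel_left] at this

/-! ### Trajectories on the half-line -/

namespace C0Semigroup

variable {X : Type*} [NormedAddCommGroup X] [NormedSpace ℂ X]
  {U : Type*} [NormedAddCommGroup U] [NormedSpace ℝ U]
  {S : C0Semigroup X} {μ : ℂ} {hμ : μ ∈ resolventSet S.generator}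
  {B : U →L[ℝ] Extrapolation S.generator μ hμ} {t : ℝ}

/-- By time invariance, a bound on `[0, t]` transfers to inputs on `[a, a + t]`. -/
theorem exists_window_trajectory {p : ℝ≥0∞} {K : ℝ≥0}
    (hK : ∀ u : ℝ → U, MemLp u p (volume.restrict (Set.Icc 0 t)) →
      ∃ x : ℝ → X, S.IsTrajectory B t u x ∧ MemLp x p (volume.restrict (Set.Icc 0 t)) ∧
        eLpNorm x p (volume.restrict (Set.Icc 0 t)) ≤
          K * eLpNorm u p (volume.restrict (Set.Icc 0 t)))
    {u : ℝ → U} (hu : MemLp u p volume) (a : ℝ) :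
    ∃ w : ℝ → X,
      (∀ᵐ τ, τ ∈ Set.Icc a (a + t) →
        S.inputMap B (τ - a) (fun s => u (s + a)) = embed S.generator μ hμ (w τ)) ∧
      AEStronglyMeasurable w (volume.restrict (Set.Icc a (a + t))) ∧
      eLpNorm w p (volume.restrict (Set.Icc a (a + t))) ≤
        K * eLpNorm u p (volume.restrict (Set.Icc a (a + t))) := by
  have hadd := measurePreserving_add_restrict_Icc a t
  have hsub := measurePreserving_sub_restrict_Icc a t
  obtain ⟨x, hx, hxm, hxn⟩ := hK (fun s => u (s + a))
    (hu.restrict _ |>.comp_measurePreserving hadd)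
  refine ⟨fun τ => x (τ - a), ?_, hxm.1.comp_measurePreserving hsub, ?_⟩
  · rw [← ae_restrict_iff' measurableSet_Icc]
    exact hsub.quasiMeasurePreserving.ae hx
  · rw [← eLpNorm_comp_measurePreserving (hu.restrict _).1 hadd]
    exact (eLpNorm_comp_measurePreserving hxm.1 hsub).trans_le hxn

/-- The bound on the half-line. At a time `τ` in `[kh, (k+1)h)` the past is split at `(k-1)h`. The
recent inputs are controlled by the bound on `[0, 2h]`. The state at time `(k-1)h` lies only in
`X₋₁`, but it has evolved for a time at least `h`, after which it lies in `X` with a norm controlled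
by its norm in `X₋₁`, that is by the exponentially weighted past. -/
theorem exists_halfLine_bound {M : ℝ≥0} {ω : ℝ} (hω : 0 < ω)
    (hM : ∀ r : ℝ≥0, ‖S.T r‖ ≤ M * Real.exp (-ω * r)) {h : ℝ} (hh : 0 < h)
    (L : Extrapolation S.generator μ hμ →L[ℂ] X)
    (hL : ∀ y, embed S.generator μ hμ (L y) = S.extrapolated μ hμ h.toNNReal y)
    {p : ℝ≥0∞} (hp₁ : 1 ≤ p) (hp : p ≠ ⊤) {K : ℝ≥0}
    (hK : ∀ u : ℝ → U, MemLp u p (volume.restrict (Set.Icc 0 (2 * h))) →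
      ∃ x : ℝ → X, S.IsTrajectory B (2 * h) u x ∧
        MemLp x p (volume.restrict (Set.Icc 0 (2 * h))) ∧
        eLpNorm x p (volume.restrict (Set.Icc 0 (2 * h))) ≤
          K * eLpNorm u p (volume.restrict (Set.Icc 0 (2 * h)))) :
    ∃ c : ℝ≥0, ∀ u : ℝ → U, StronglyMeasurable u → Integrable u → MemLp u p volume →
      (∀ s < 0, u s = 0) →
      ∃ x : ℝ → X, (∀ᵐ τ, S.inputMap B τ u = embed S.generator μ hμ (x τ)) ∧
        MemLp x p volume ∧ eLpNorm x p volume ≤ c * eLpNorm u p volume := by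
  have hMle := norm_le_of_norm_le_exp hω hM
  have hfin := isFiniteMeasure_expMeasure hω
  -- the norms of `T(τ - kh)`, `T₋₁(h) : X₋₁ → X` and `B`; the exponential shifts the weight from
  -- `(k-1)h` to `τ`, at distance at most `2h`
  set C : ℝ≥0 := M * ‖L‖₊ * (M * ‖B‖ * Real.exp (ω * (2 * h))).toNNReal with hC
  set c : ℝ≥0∞ := K * 2 ^ (1 / p.toReal) + C * expMeasure ω Set.univ with hc
  have hctop : c ≠ ⊤ := ENNReal.add_ne_top.2
    ⟨ENNReal.mul_ne_top ENNReal.coe_ne_top (ENNReal.rpow_ne_top_of_nonneg (by positivity) (by simp)),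
      ENNReal.mul_ne_top ENNReal.coe_ne_top (measure_ne_top _ _)⟩
  refine ⟨c.toNNReal, fun u hum hui hu hu₀ => ?_⟩
  rw [ENNReal.coe_toNNReal hctop]
  choose w hw hwm hwn using fun k : ℤ => exists_window_trajectory hK hu (((k : ℝ) - 1) * h)
  have hsub : ∀ k : ℤ, Set.Ico (k • h) ((k + 1) • h) ⊆
      Set.Icc (((k : ℝ) - 1) * h) ((k - 1) * h + 2 * h) := by
    intro k τ hτ
    simp only [zsmul_eq_mul, Set.mem_Ico, Int.cast_add, Int.cast_one] at hτ
    constructor <;> nlinarith [hτ.1, hτ.2]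
  have hmem : ∀ τ : ℝ, τ ∈ Set.Ico (⌊τ / h⌋ • h) ((⌊τ / h⌋ + 1) • h) := fun τ =>
    (mem_Ico_zsmul_iff hh _ τ).2 rfl
  let z : ℤ → X := fun k => L (S.inputMap B (((k : ℝ) - 1) * h) u)
  let y : ℤ → ℝ → X := fun k τ => S.T (τ - k * h).toNNReal (z k)
  have hym : AEStronglyMeasurable (fun τ => y ⌊τ / h⌋ τ) volume :=
    aestronglyMeasurable_piecewise_floor hh fun k =>
      ((S.continuous_orbit (z k)).comp (by fun_prop)).aestronglyMeasurable
  have hwm' : AEStronglyMeasurable (fun τ => w ⌊τ / h⌋ τ) volume :=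
    aestronglyMeasurable_piecewise_floor hh fun k =>
      (hwm k).mono_measure (Measure.restrict_mono_set _ (hsub k))
  have hwb : eLpNorm (fun τ => w ⌊τ / h⌋ τ) p volume ≤
      K * 2 ^ (1 / p.toReal) * eLpNorm u p volume :=
    eLpNorm_piecewise_floor_le hp₁ hp hh fun k =>
      (eLpNorm_mono_measure _ (Measure.restrict_mono_set _ (hsub k))).trans (hwn k)
  have hyb : eLpNorm (fun τ => y ⌊τ / h⌋ τ) p volume ≤
      C * expMeasure ω Set.univ * eLpNorm u p volume := by
    have hpt : ∀ τ, ‖y ⌊τ / h⌋ τ‖ₑ ≤ C * ‖∫⁻ r, ‖u (τ - r)‖ₑ ∂(expMeasure ω)‖ₑ := by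
      intro τ
      set k := ⌊τ / h⌋
      have hτ := hsub k (hmem τ)
      calc ‖y k τ‖ₑ ≤ M * ‖z k‖ₑ := by
            refine ((S.T _).le_opENorm _).trans ?_
            gcongr
            rw [enorm_eq_nnnorm]
            exact ENNReal.coe_le_coe.2 (hMle _)
        _ ≤ M * (‖L‖ₑ * ‖S.inputMap B (((k : ℝ) - 1) * h) u‖ₑ) := by
            gcongr
            exact L.le_opENorm _
        _ ≤ M * (‖L‖ₑ * (ENNReal.ofReal (M * ‖B‖ * Real.exp (ω * (2 * h))) *
              ∫⁻ r, ‖u (τ - r)‖ₑ ∂(expMeasure ω))) := by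
            gcongr
            refine (S.enorm_inputMap_le B hM hum hu₀ hτ.1).trans ?_
            gcongr
            linarith [hτ.2]
        _ = C * ‖∫⁻ r, ‖u (τ - r)‖ₑ ∂(expMeasure ω)‖ₑ := by
            rw [enorm_eq_self, hC, ENNReal.coe_mul, ENNReal.coe_mul, enorm_eq_nnnorm, ENNReal.ofReal]
            ring
    refine (eLpNorm_le_mul_eLpNorm_of_ae_le_mul' (Eventually.of_forall hpt) p).trans ?_
    rw [mul_assoc]
    gcongr
    refine (eLpNorm_lintegral_sub_le hp₁ hp (expMeasure ω) hum.enorm).trans_eq ?_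
    rw [eLpNorm_enorm]
  have hxm := hwm'.add hym
  have hxb : eLpNorm ((fun τ => w ⌊τ / h⌋ τ) + fun τ => y ⌊τ / h⌋ τ) p volume ≤
      c * eLpNorm u p volume := by
    rw [hc, add_mul]
    exact (eLpNorm_add_le hwm' hym hp₁).trans (add_le_add hwb hyb)
  refine ⟨_, ?_, ⟨hxm, hxb.trans_lt (ENNReal.mul_lt_top hctop.lt_top hu.2)⟩, hxb⟩
  filter_upwards [ae_all_iff.2 hw] with τ hτ
  set k := ⌊τ / h⌋ with hk
  have hτk := hsub k (hmem τ)
  have hτ0 : 0 ≤ τ - k * h := by simpa using (hmem τ).1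
  have hsplit : τ - ((k : ℝ) - 1) * h = (τ - k * h) + h := by ring
  rw [S.inputMap_eq_add B hMle hui hu₀ hτk.1, hτ k hτk, Pi.add_apply, _root_.map_add, ← hk,
    hsplit, Real.toNNReal_add hτ0 hh.le, extrapolated_add, ← hL, extrapolated_embed]

end C0Semigroup

theorem mainTheorem1 {X U : Type*} [NormedAddCommGroup X] [NormedSpace ℂ X] [CompleteSpace X]
    [NormedAddCommGroup U] [NormedSpace ℝ U] [CompleteSpace U]
    (S : C0Semigroup X) (μ : ℂ) (hμ : μ ∈ UnboundedOperator.resolventSet S.generator)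
    (B : U →L[ℝ] UnboundedOperator.Extrapolation S.generator μ hμ)
    (hstable : S.IsExponentiallyStable) (hanalytic : S.IsAnalytic)
    (p : ℝ≥0∞) (hp₁ : 1 ≤ p) (hp : p ≠ ⊤) :
    S.IsAdmissible B p p ↔ S.IsInfiniteTimeAdmissible B p p := by
  refine ⟨fun hadm => ⟨hadm, ?_⟩, fun h => h.1⟩
  obtain ⟨t₀, ht₀, hadm⟩ := hadm
  obtain ⟨M, hM0, ω, hω, hM⟩ := hstable
  lift M to ℝ≥0 using hM0.le
  have hMle := C0Semigroup.norm_le_of_norm_le_exp hω hM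
  -- the recent past has length up to `2h`, so `2h` is taken as the admissible horizon
  obtain ⟨h, rfl⟩ : ∃ h, t₀ = 2 * h := ⟨t₀ / 2, by ring⟩
  have hh : 0 < h := by linarith
  obtain ⟨K, hK⟩ := C0Semigroup.exists_bound_of_forall_exists_isTrajectory hMle hp₁ hadm
  obtain ⟨L, hL⟩ := hanalytic.exists_smoothing μ hμ (Real.toNNReal_pos.2 hh)
  obtain ⟨c, hc⟩ := C0Semigroup.exists_halfLine_bound hω hM hh L hL hp₁ hp hK
  refine ⟨c, fun t _ u hu => ?_⟩
  -- extend a strongly measurable representative of the input by zero to the whole line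
  set v := (Set.Icc 0 t).indicator (hu.1.mk u) with hv
  have huv : u =ᵐ[volume.restrict (Set.Icc 0 t)] v :=
    hu.1.ae_eq_mk.trans (indicator_ae_eq_restrict measurableSet_Icc).symm
  have hmk : MemLp (hu.1.mk u) p (volume.restrict (Set.Icc 0 t)) := hu.ae_eq hu.1.ae_eq_mk
  obtain ⟨x, hx, hxm, hxn⟩ := hc v (hu.1.stronglyMeasurable_mk.indicator measurableSet_Icc)
    ((integrable_indicator_iff measurableSet_Icc).2 (hmk.integrable hp₁))
    ((memLp_indicator_iff_restrict measurableSet_Icc).2 hmk)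
    fun s hs => Set.indicator_of_notMem (fun hs' => not_lt.2 hs'.1 hs) _
  refine ⟨x, C0Semigroup.IsTrajectory.congr (ae_restrict_of_ae hx) huv.symm EventuallyEq.rfl,
    hxm.restrict _, ?_⟩
  refine (eLpNorm_mono_measure _ Measure.restrict_le_self).trans (hxn.trans_eq ?_)
  rw [hv, eLpNorm_indicator_eq_eLpNorm_restrict measurableSet_Icc, ← eLpNorm_congr_ae hu.1.ae_eq_mk]
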